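/- Let $\alpha,\beta\in\mathbb C$ with $\alpha+\beta\neq 0$, and let $$\mathfrak h=\left\{\begin{pmatrix} x_1+x_2 & x_1+x_2 & 0 & x_1\\ x_1+x_2 & x_1+x_2 & 0 & x_2\\ \alpha x_1+(\beta-1)x_2 & \beta x_1+(\alpha+1)x_2 & 0 & x_3\\ 0&0&0&0\end{pmatrix} : x_1,x_2,x_3\in\mathbb C\right\}\subset \mathfrak{gl}(4,\mathbb C).$$ Let $X_i\in\mathfrak h$ be the matrix with $x_i=1$ and $x_j=0$ for $j\ne i$. Then $X_1,X_2,X_3$ is a basis of $\mathfrak h$ and $[X_1,X_2]=X_3$, $[X_1,X_3]=[X_2,X_3]=0$, so that $\mathfrak h$ is a 3-dimensional nilpotent Lie subalgebra of $\mathfrak{gl}(4,\mathbb C)$; it is isomorphic to the Heisenberg algebra of strictly upper triangular complex $3\times 3$ matrices. The Jordan decomposition $X_1=X_{1,s}+X_{1,n}$ into commuting semisimple and nilpotent parts is $$X_{1,s}=\begin{pmatrix}1&1&0&\frac12\\1&1&0&\frac12\\ \frac{\alpha+\beta}2&\frac{\alpha+\beta}2&0&\frac{\alpha+\beta}4\\0&0&0&0\end{pmatrix},\qquad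 X_{1,n}=\begin{pmatrix}0&0&0&\frac12\\0&0&0&-\frac12\\ \frac{\alpha-\beta}2&-\frac{\alpha-\beta}2&0&-\frac{\alpha+\beta}4\\0&0&0&0\end{pmatrix},$$ and neither $X_{1,s}$ nor $X_{1,n}$ belongs to $\mathfrak h$. Moreover, $\mathfrak h$ is not algebraic: there is no subgroup $G\subset GL(4,\mathbb C)$ that is the zero set in $GL(4,\mathbb C)$ of a set of polynomials in the matrix entries and whose Lie algebra is $\mathfrak h$. Here the Lie algebra of $G$ is the set of all $X\in\mathfrak{gl}(4,\mathbb C)$ such that $dP(X)=0$ for every polynomial $P$ in the matrix entries that vanishes on $G$, where $dP$ is the differential of $P$ at the identity matrix. -/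

import Mathlib

open Matrix

attribute [local instance 100] LieRing.ofAssociativeRing

/-- A subgroup `G` of `GL(n, K)` is algebraic (Zariski closed) if it is the set of all invertible
matrices at which every member of some set `S` of polynomials in the matrix entries vanishes. -/
def IsAlgebraicSubgroup {n K : Type*} [Fintype n] [DecidableEq n] [Field K]
    (G : Subgroup (GL n K)) : Prop :=
  ∃ S : Set (MvPolynomial (n × n) K), ∀ g : GL n K,
    g ∈ G ↔ ∀ P ∈ S, MvPolynomial.eval (fun ij => (g : Matrix n n K) ij.1 ij.2) P = 0

/-- The ideal `I(G)` of all polynomials in the matrix entries that vanish on `G`. -/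
def vanishingIdealOfSubgroup {n K : Type*} [Fintype n] [DecidableEq n] [Field K]
    (G : Subgroup (GL n K)) : Ideal (MvPolynomial (n × n) K) :=
  MvPolynomial.vanishingIdeal K
    ((fun (g : GL n K) (ij : n × n) => (g : Matrix n n K) ij.1 ij.2) '' (G : Set (GL n K)))

/-- The differential `dP(X) = ∑ i j, (∂P/∂x_ij)(1) * X i j` at the identity matrix of a polynomial
`P` in the matrix entries, as a linear form in `X`. -/
noncomputable def differentialAtOne {n K : Type*} [Fintype n] [DecidableEq n] [Field K]
    (P : MvPolynomial (n × n) K) : Matrix n n K →ₗ[K] K where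
  toFun X := ∑ ij : n × n,
    MvPolynomial.eval (fun kl => (1 : Matrix n n K) kl.1 kl.2) (MvPolynomial.pderiv ij P) *
      X ij.1 ij.2
  map_add' X Y := by simp [mul_add, Finset.sum_add_distrib]
  map_smul' c X := by simp [Finset.mul_sum, mul_left_comm]

/-- (The underlying vector space of) the Lie algebra of `G`: all matrices `X` such that `dP(X) = 0`
for every `P` in the ideal `I(G)`. -/
noncomputable def lieAlgebraOfSubgroup {n K : Type*} [Fintype n] [DecidableEq n] [Field K]
    (G : Subgroup (GL n K)) : Submodule K (Matrix n n K) :=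
  ⨅ P ∈ vanishingIdealOfSubgroup G, LinearMap.ker (differentialAtOne P)

/-- A Lie subalgebra of `gl(n, K)` is algebraic if it is the Lie algebra of some algebraic subgroup
of `GL(n, K)`. -/
def IsAlgebraicLieSubalgebra {n K : Type*} [Fintype n] [DecidableEq n] [Field K]
    (L : LieSubalgebra K (Matrix n n K)) : Prop :=
  ∃ G : Subgroup (GL n K), IsAlgebraicSubgroup G ∧ L.toSubmodule = lieAlgebraOfSubgroup G

/-- The 3-dimensional complex Heisenberg algebra: strictly upper triangular `3 × 3` matrices. -/
def heisenbergAlgebra : LieSubalgebra ℂ (Matrix (Fin 3) (Fin 3) ℂ) where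
  carrier := {A | ∀ i j, j ≤ i → A i j = 0}
  add_mem' := by
    intro A B hA hB i j h
    simp [hA i j h, hB i j h]
  zero_mem' := by
    intro i j _
    rfl
  smul_mem' := by
    intro c A hA i j h
    simp [hA i j h]
  lie_mem' := by
    intro A B hA hB i j h
    have key : ∀ C D : Matrix (Fin 3) (Fin 3) ℂ, (∀ i j, j ≤ i → C i j = 0) →
        (∀ i j, j ≤ i → D i j = 0) → (C * D) i j = 0 := by
      intro C D hC hD
      rw [Matrix.mul_apply]
      refine Finset.sum_eq_zero fun k _ => ?_
      rcases le_total k i with hk | hk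
      · rw [hC i k hk, zero_mul]
      · rw [hD k j (h.trans hk), mul_zero]
    rw [Ring.lie_def, Matrix.sub_apply, key A B hA hB, key B A hB hA, sub_zero]

/-- The general element of the subspace `𝔥`. -/
def hElement (α β x₁ x₂ x₃ : ℂ) : Matrix (Fin 4) (Fin 4) ℂ :=
  !![x₁ + x₂, x₁ + x₂, 0, x₁;
     x₁ + x₂, x₁ + x₂, 0, x₂;
     α * x₁ + (β - 1) * x₂, β * x₁ + (α + 1) * x₂, 0, x₃;
     0, 0, 0, 0]

def matX₁ (α β : ℂ) : Matrix (Fin 4) (Fin 4) ℂ :=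
  !![1, 1, 0, 1;
     1, 1, 0, 0;
     α, β, 0, 0;
     0, 0, 0, 0]

def matX₂ (α β : ℂ) : Matrix (Fin 4) (Fin 4) ℂ :=
  !![1, 1, 0, 0;
     1, 1, 0, 1;
     β - 1, α + 1, 0, 0;
     0, 0, 0, 0]

def matX₃ : Matrix (Fin 4) (Fin 4) ℂ :=
  !![0, 0, 0, 0;
     0, 0, 0, 0;
     0, 0, 0, 1;
     0, 0, 0, 0]

/-- The semisimple part of `X₁`. -/
noncomputable def matX₁s (α β : ℂ) : Matrix (Fin 4) (Fin 4) ℂ :=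
  !![1, 1, 0, 1 / 2;
     1, 1, 0, 1 / 2;
     (α + β) / 2, (α + β) / 2, 0, (α + β) / 4;
     0, 0, 0, 0]

/-- The nilpotent part of `X₁`. -/
noncomputable def matX₁n (α β : ℂ) : Matrix (Fin 4) (Fin 4) ℂ :=
  !![0, 0, 0, 1 / 2;
     0, 0, 0, -1 / 2;
     (α - β) / 2, -(α - β) / 2, 0, -(α + β) / 4;
     0, 0, 0, 0]

/-!
A matrix `A` lies in the Lie algebra of a group `G` of invertible matrices exactly when the
left-invariant derivation `D_A` of the polynomials in the matrix entries maps the ideal `I(G)` into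
itself. On each row of the generic matrix `D_A` is right multiplication by `A`; hence by the Leibniz
rule `D_S` is diagonalizable if `S` is, and `D_N` is locally nilpotent if `N` is nilpotent. If `S`
and `N` commute, every eigenspace of `D_S` lies in a generalized eigenspace of `D_S + D_N`, and a
subspace stable under `D_S + D_N` contains the generalized eigencomponents of its elements, so it is
stable under `D_S`. Thus the Lie algebra of `G` contains the semisimple part of each of its
elements. But the element of `𝔥` with the same last column as `X₁,s` has entry `(α + β - 1) / 2`
at position `(3, 1)`, where `X₁,s` has `(α + β) / 2`.
-/

section Endomorphisms

open Module.End

theorem genEigenspace_le_comap_of_comp_eq {R M N : Type*} [CommRing R] [AddCommGroup M]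
    [Module R M] [AddCommGroup N] [Module R N] {f : Module.End R M} {g : Module.End R N}
    {φ : N →ₗ[R] M} (h : f ∘ₗ φ = φ ∘ₗ g) (μ : R) (k : ℕ∞) :
    g.genEigenspace μ k ≤ (f.genEigenspace μ k).comap φ := by
  intro v hv
  obtain ⟨l, hl, hv⟩ := mem_genEigenspace.mp hv
  have hμ : (f - μ • 1) ∘ₗ φ = φ ∘ₗ (g - μ • 1) := by
    rw [LinearMap.sub_comp, LinearMap.comp_sub, h]
    ext
    simp
  have hpow := LinearMap.congr_fun (commute_pow_left_of_commute hμ l) v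
  refine mem_genEigenspace.mpr ⟨l, hl, ?_⟩
  rw [LinearMap.mem_ker] at hv ⊢
  simpa [hv] using hpow

theorem maxGenEigenspace_zero_eq_top_of_isNilpotent {R M : Type*} [CommRing R] [AddCommGroup M]
    [Module R M] {f : Module.End R M} (hf : IsNilpotent f) : f.maxGenEigenspace 0 = ⊤ := by
  obtain ⟨k, hk⟩ := hf
  exact eq_top_iff.mpr fun v _ => (mem_maxGenEigenspace f 0 v).mpr ⟨k, by simp [hk]⟩

theorem mem_maxGenEigenspace_of_sub_smul_mem {R M : Type*} [CommRing R] [AddCommGroup M]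
    [Module R M] {f : Module.End R M} {μ : R} {v : M}
    (h : f v - μ • v ∈ f.maxGenEigenspace μ) : v ∈ f.maxGenEigenspace μ := by
  obtain ⟨k, hk⟩ := (mem_maxGenEigenspace f μ _).mp h
  exact (mem_maxGenEigenspace f μ v).mpr ⟨k + 1, by rw [pow_succ]; exact hk⟩

variable {K V : Type*} [Field K] [AddCommGroup V] [Module K V]

theorem mem_of_sum_mem_of_mem_maxGenEigenspace {f : Module.End K V} {p : Submodule K V}
    (hp : p ∈ f.invtSubmodule) {s : Finset K} {v : K → V}
    (hv : ∀ μ ∈ s, v μ ∈ f.maxGenEigenspace μ) (hsum : ∑ μ ∈ s, v μ ∈ p) :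
    ∀ μ ∈ s, v μ ∈ p := by
  -- The generalized eigenspaces of the endomorphism induced on `V ⧸ p` are independent.
  have hquot : p.mapQ p f hp ∘ₗ p.mkQ = p.mkQ ∘ₗ f := p.mapQ_mkQ p f
  have hzero : ∑ μ ∈ s, p.mkQ (v μ) = 0 := by
    rwa [← map_sum, Submodule.mkQ_apply, Submodule.Quotient.mk_eq_zero]
  intro μ hμ
  rw [← Submodule.Quotient.mk_eq_zero, ← Submodule.mkQ_apply]
  exact (iSupIndep_iff_finsetSum_eq_zero_imp_eq_zero _).mp
    (independent_maxGenEigenspace (p.mapQ p f hp)) s _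
    (fun μ hμ => genEigenspace_le_comap_of_comp_eq hquot μ ⊤ (hv μ hμ)) hzero μ hμ

theorem mem_invtSubmodule_of_add_of_commute {f g : Module.End K V} (hfg : Commute f g)
    (hf : ⨆ μ, f.eigenspace μ = ⊤) (hg : g.maxGenEigenspace 0 = ⊤) {p : Submodule K V}
    (hp : p ∈ (f + g).invtSubmodule) : p ∈ f.invtSubmodule := by
  have hle (μ : K) : f.eigenspace μ ≤ (f + g).maxGenEigenspace μ := fun v hv => by
    simpa using genEigenspace_inf_le_add f g μ 0 ⊤ ⊤ hfg
      ⟨eigenspace_le_maxGenEigenspace hv, hg.ge trivial⟩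
  intro v hv
  obtain ⟨m, hm, rfl⟩ := (Submodule.mem_iSup_iff_exists_finsupp _ v).mp (hf ▸ Submodule.mem_top)
  have hmp := mem_of_sum_mem_of_mem_maxGenEigenspace hp (fun μ _ => hle μ (hm μ)) hv
  rw [Submodule.mem_comap, Finsupp.sum, map_sum]
  refine sum_mem fun μ hμ => ?_
  rw [mem_eigenspace_iff.mp (hm μ)]
  exact p.smul_mem μ (hmp μ hμ)

open Polynomial in
theorem isSemisimple_of_mul_self_eq_smul {f : Module.End K V} {c : K} (hc : c ≠ 0)
    (hf : f * f = c • f) : f.IsSemisimple := by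
  have hcop : IsCoprime (X : K[X]) (X - C c) := by
    simpa using isCoprime_X_sub_C_of_isUnit_sub (a := (0 : K)) (b := c) (by simpa using hc)
  have hsep : (X * (X - C c)).Separable := separable_X.mul separable_X_sub_C hcop
  refine Module.End.isSemisimple_of_squarefree_aeval_eq_zero hsep.squarefree ?_
  simp [mul_sub, hf, Algebra.algebraMap_eq_smul_one]

end Endomorphisms

theorem isNilpotent_of_lie_lie_eq_zero {L : Type*} [LieRing L]
    (h : ∀ x y z : L, ⁅x, ⁅y, z⁆⁆ = 0) : LieRing.IsNilpotent L := by
  refine (LieModule.isNilpotent_iff ℤ L L).mpr ⟨2, eq_bot_iff.mpr ?_⟩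
  rw [LieModule.lowerCentralSeries_succ, LieModule.lowerCentralSeries_succ,
    LieModule.lowerCentralSeries_zero, LieSubmodule.lie_le_iff]
  intro x _ w hw
  have hle : ⁅(⊤ : LieIdeal ℤ L), (⊤ : LieSubmodule ℤ L L)⁆ ≤ LieModule.maxTrivSubmodule ℤ L L :=
    (LieSubmodule.lie_le_iff _ _ _).mpr fun y _ z _ u => h u y z
  exact hle hw x

section Derivations

open Module.End

variable {R A : Type*} [CommRing R] [CommRing A] [Algebra R A] (D : Derivation R A A)

theorem mul_mem_eigenspace_derivation {μ ν : R} {a b : A} (ha : a ∈ eigenspace D.toLinearMap μ)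
    (hb : b ∈ eigenspace D.toLinearMap ν) : a * b ∈ eigenspace D.toLinearMap (μ + ν) := by
  rw [mem_eigenspace_iff, Derivation.coeFn_coe] at *
  rw [D.leibniz, ha, hb, smul_eq_mul, smul_eq_mul, mul_smul_comm, mul_smul_comm, mul_comm b a,
    add_smul, add_comm]

theorem mul_mem_iSup_eigenspace_derivation {a b : A} (ha : a ∈ ⨆ μ, eigenspace D.toLinearMap μ)
    (hb : b ∈ ⨆ μ, eigenspace D.toLinearMap μ) : a * b ∈ ⨆ μ, eigenspace D.toLinearMap μ := by
  have hle : (⨆ μ, eigenspace D.toLinearMap μ) * (⨆ ν, eigenspace D.toLinearMap ν) ≤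
      ⨆ μ, eigenspace D.toLinearMap μ := by
    simp only [Submodule.iSup_mul, Submodule.mul_iSup, iSup_le_iff, Submodule.mul_le]
    exact fun μ ν x hx y hy =>
      Submodule.mem_iSup_of_mem (ν + μ) (mul_mem_eigenspace_derivation D hx hy)
  exact hle (Submodule.mul_mem_mul ha hb)

theorem mul_mem_maxGenEigenspace_derivation {μ ν : R} {a b : A}
    (ha : a ∈ maxGenEigenspace D.toLinearMap μ) (hb : b ∈ maxGenEigenspace D.toLinearMap ν) :
    a * b ∈ maxGenEigenspace D.toLinearMap (μ + ν) := by
  obtain ⟨k, hk⟩ := (mem_maxGenEigenspace _ _ _).mp ha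
  obtain ⟨l, hl⟩ := (mem_maxGenEigenspace _ _ _).mp hb
  clear ha hb
  induction k generalizing a b l with
  | zero =>
    obtain rfl : a = 0 := hk
    simp
  | succ k ihk =>
    induction l generalizing b with
    | zero =>
      obtain rfl : b = 0 := hl
      simp
    | succ l ihl =>
      have hleibniz : D (a * b) - (μ + ν) • (a * b) =
          (D a - μ • a) * b + a * (D b - ν • b) := by
        simp only [D.leibniz, smul_eq_mul, Algebra.smul_def, map_add]
        ring
      refine mem_maxGenEigenspace_of_sub_smul_mem ?_
      rw [Derivation.coeFn_coe, hleibniz]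
      refine add_mem (ihk ?_ (l + 1) hl) (ihl ?_)
      · rwa [pow_succ] at hk
      · rwa [pow_succ] at hl

variable {D} {s : Set A}

theorem iSup_eigenspace_derivation_eq_top (hs : Algebra.adjoin R s = ⊤)
    (h : ∀ a ∈ s, a ∈ ⨆ μ, eigenspace D.toLinearMap μ) :
    ⨆ μ, eigenspace D.toLinearMap μ = ⊤ := by
  refine eq_top_iff.mpr fun a _ => ?_
  have ha : a ∈ Algebra.adjoin R s := hs ▸ Algebra.mem_top
  induction ha using Algebra.adjoin_induction with
  | mem a ha => exact h a ha
  | algebraMap r => exact Submodule.mem_iSup_of_mem 0 (mem_eigenspace_iff.mpr (by simp))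
  | add a b _ _ ha hb => exact add_mem (ha trivial) (hb trivial)
  | mul a b _ _ ha hb => exact mul_mem_iSup_eigenspace_derivation D (ha trivial) (hb trivial)

theorem maxGenEigenspace_zero_derivation_eq_top (hs : Algebra.adjoin R s = ⊤)
    (h : ∀ a ∈ s, a ∈ maxGenEigenspace D.toLinearMap 0) :
    maxGenEigenspace D.toLinearMap 0 = ⊤ := by
  refine eq_top_iff.mpr fun a _ => ?_
  have ha : a ∈ Algebra.adjoin R s := hs ▸ Algebra.mem_top
  induction ha using Algebra.adjoin_induction with
  | mem a ha => exact h a ha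
  | algebraMap r => exact eigenspace_le_maxGenEigenspace (mem_eigenspace_iff.mpr (by simp))
  | add a b _ _ ha hb => exact add_mem (ha trivial) (hb trivial)
  | mul a b _ _ ha hb =>
    simpa using mul_mem_maxGenEigenspace_derivation D (ha trivial) (hb trivial)

end Derivations

section LeftInvariantDerivations

open MvPolynomial

theorem derivation_apply_eq_sum_pderiv {σ R M : Type*} [Fintype σ] [CommSemiring R]
    [AddCommMonoid M] [Module R M] [Module (MvPolynomial σ R) M]
    [IsScalarTower R (MvPolynomial σ R) M] (D : Derivation R (MvPolynomial σ R) M)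
    (P : MvPolynomial σ R) : D P = ∑ i, pderiv i P • D (X i) := by
  classical
  induction P using MvPolynomial.induction_on with
  | C a => simp
  | add P Q hP hQ => simp only [map_add, hP, hQ, add_smul, Finset.sum_add_distrib]
  | mul_X P j hP =>
    simp only [Derivation.leibniz, hP, pderiv_X, smul_eq_mul, add_smul, mul_smul,
      Finset.sum_add_distrib, ← Finset.smul_sum]
    simp [Pi.single_apply, ite_smul]

variable {n R : Type*} [Fintype n] [CommRing R]

/-- The `i`-th entry of the product of the generic matrix `(x_ij)` with the vector `v`, as a linear
function of `v`. -/
noncomputable def genericRow (i : n) : (n → R) →ₗ[R] MvPolynomial (n × n) R :=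
  Fintype.linearCombination R fun j => X (i, j)

theorem genericRow_single_one [DecidableEq n] (i j : n) :
    genericRow i (Pi.single j (1 : R)) = X (i, j) := by
  simp [genericRow]

/-- The derivation `D_A` of the polynomials in the matrix entries determined by
`D_A (x_ij) = (x A)_ij`, that is, the left-invariant vector field on the general linear group with
value `A` at the identity. -/
noncomputable def leftInvariantDerivation :
    Matrix n n R →ₗ[R] Derivation R (MvPolynomial (n × n) R) (MvPolynomial (n × n) R) where
  toFun A := mkDerivation R fun ij => genericRow ij.1 (A.col ij.2)
  map_add' A B := derivation_ext fun ij => by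
    simp only [Derivation.add_apply, mkDerivation_X]
    exact (genericRow ij.1).map_add (A.col ij.2) (B.col ij.2)
  map_smul' c A := derivation_ext fun ij => by
    simp only [Derivation.smul_apply, mkDerivation_X]
    exact (genericRow ij.1).map_smul c (A.col ij.2)

theorem leftInvariantDerivation_X (A : Matrix n n R) (ij : n × n) :
    leftInvariantDerivation A (X ij) = genericRow ij.1 (A.col ij.2) :=
  mkDerivation_X _ _ _

theorem leftInvariantDerivation_comp_genericRow (A : Matrix n n R) (i : n) :
    (leftInvariantDerivation A).toLinearMap ∘ₗ genericRow i = genericRow i ∘ₗ A.mulVecLin := by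
  classical
  refine LinearMap.pi_ext' fun j => LinearMap.ext_ring ?_
  simp [genericRow_single_one, leftInvariantDerivation_X]

theorem leftInvariantDerivation_lie (A B : Matrix n n R) :
    leftInvariantDerivation ⁅A, B⁆ = ⁅leftInvariantDerivation A, leftInvariantDerivation B⁆ := by
  refine derivation_ext fun ⟨i, j⟩ => ?_
  have hrow (C : Matrix n n R) (v : n → R) :
      leftInvariantDerivation C (genericRow i v) = genericRow i (C *ᵥ v) :=
    LinearMap.congr_fun (leftInvariantDerivation_comp_genericRow C i) v
  rw [Derivation.commutator_apply]
  simp only [leftInvariantDerivation_X, hrow]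
  rw [← map_sub]
  rfl

theorem commute_leftInvariantDerivation {A B : Matrix n n R} (h : Commute A B) :
    Commute (leftInvariantDerivation A : Module.End R (MvPolynomial (n × n) R))
      (leftInvariantDerivation B) := by
  rw [commute_iff_lie_eq, ← Derivation.commutator_coe_linear_map, ← leftInvariantDerivation_lie,
    h.lie_eq, map_zero, Derivation.coe_zero_linearMap]

theorem iSup_eigenspace_leftInvariantDerivation_eq_top {A : Matrix n n R}
    (hA : ⨆ μ, Module.End.eigenspace A.mulVecLin μ = ⊤) :
    ⨆ μ, Module.End.eigenspace (leftInvariantDerivation A).toLinearMap μ = ⊤ := by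
  classical
  refine iSup_eigenspace_derivation_eq_top adjoin_range_X ?_
  rintro _ ⟨⟨i, j⟩, rfl⟩
  have hle : ⨆ μ, Module.End.eigenspace A.mulVecLin μ ≤
      (⨆ μ, Module.End.eigenspace (leftInvariantDerivation A).toLinearMap μ).comap
        (genericRow i) :=
    iSup_le fun μ => (genEigenspace_le_comap_of_comp_eq
      (leftInvariantDerivation_comp_genericRow A i) μ 1).trans
        (Submodule.comap_mono
          (le_iSup (Module.End.eigenspace (leftInvariantDerivation A).toLinearMap) μ))
  rw [← genericRow_single_one]
  exact hle (hA.ge trivial)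

theorem maxGenEigenspace_zero_leftInvariantDerivation_eq_top {A : Matrix n n R}
    (hA : Module.End.maxGenEigenspace A.mulVecLin 0 = ⊤) :
    Module.End.maxGenEigenspace (leftInvariantDerivation A).toLinearMap 0 = ⊤ := by
  classical
  refine maxGenEigenspace_zero_derivation_eq_top adjoin_range_X ?_
  rintro _ ⟨⟨i, j⟩, rfl⟩
  rw [← genericRow_single_one]
  exact genEigenspace_le_comap_of_comp_eq (leftInvariantDerivation_comp_genericRow A i) 0 ⊤
    (hA.ge trivial)

/-- Evaluation of a polynomial in the matrix entries at the matrix `g`. -/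
noncomputable def evalMatrix (g : Matrix n n R) : MvPolynomial (n × n) R →ₐ[R] R :=
  aeval fun ij => g ij.1 ij.2

theorem evalMatrix_genericRow (g : Matrix n n R) (i : n) (v : n → R) :
    evalMatrix g (genericRow i v) = (g *ᵥ v) i := by
  simp [evalMatrix, genericRow, Fintype.linearCombination_apply, Matrix.mulVec, dotProduct,
    mul_comm]

/-- Left translation `P(x) ↦ P(g x)` of polynomials in the matrix entries. -/
noncomputable def leftTranslate (g : Matrix n n R) :
    MvPolynomial (n × n) R →ₐ[R] MvPolynomial (n × n) R :=
  aeval fun ij => ∑ k, g ij.1 k • X (k, ij.2)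

theorem evalMatrix_leftTranslate (g h : Matrix n n R) (P : MvPolynomial (n × n) R) :
    evalMatrix h (leftTranslate g P) = evalMatrix (g * h) P := by
  have hcomp : (evalMatrix h).comp (leftTranslate g) = evalMatrix (g * h) :=
    algHom_ext fun ij => by simp [evalMatrix, leftTranslate, Matrix.mul_apply]
  exact DFunLike.congr_fun hcomp P

theorem leftTranslate_genericRow (g : Matrix n n R) (i : n) (v : n → R) :
    leftTranslate g (genericRow i v) = ∑ k, g i k • genericRow k v := by
  simp only [genericRow, Fintype.linearCombination_apply, map_sum, map_smul, leftTranslate,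
    aeval_X, Finset.smul_sum]
  rw [Finset.sum_comm]
  simp only [smul_comm (v _)]

theorem leftInvariantDerivation_leftTranslate (A g : Matrix n n R) (P : MvPolynomial (n × n) R) :
    leftInvariantDerivation A (leftTranslate g P) =
      leftTranslate g (leftInvariantDerivation A P) := by
  have hX (i j : n) : leftInvariantDerivation A (leftTranslate g (X (i, j))) =
      leftTranslate g (leftInvariantDerivation A (X (i, j))) := by
    rw [leftInvariantDerivation_X, leftTranslate_genericRow]
    simp [leftTranslate, leftInvariantDerivation_X]
  induction P using MvPolynomial.induction_on with
  | C a => simp [leftTranslate, ← algebraMap_eq]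
  | add P Q hP hQ => simp only [map_add, hP, hQ]
  | mul_X P ij hP =>
    simp only [map_mul, Derivation.leibniz, map_add, smul_eq_mul, hX, hP]

end LeftInvariantDerivations

section LieAlgebraOfSubgroup

open MvPolynomial

variable {n K : Type*} [Fintype n] [DecidableEq n] [Field K]

theorem differentialAtOne_eq_evalMatrix_one (P : MvPolynomial (n × n) K) (A : Matrix n n K) :
    differentialAtOne P A = evalMatrix 1 (leftInvariantDerivation A P) := by
  rw [derivation_apply_eq_sum_pderiv, map_sum]
  simp only [smul_eq_mul, map_mul, leftInvariantDerivation_X, evalMatrix_genericRow, one_mulVec]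
  rfl

variable {G : Subgroup (GL n K)}

theorem mem_vanishingIdealOfSubgroup {P : MvPolynomial (n × n) K} :
    P ∈ vanishingIdealOfSubgroup G ↔ ∀ g ∈ G, evalMatrix (g : Matrix n n K) P = 0 := by
  simp [vanishingIdealOfSubgroup, mem_vanishingIdeal_iff, evalMatrix]

theorem mem_lieAlgebraOfSubgroup {A : Matrix n n K} :
    A ∈ lieAlgebraOfSubgroup G ↔ ∀ P ∈ vanishingIdealOfSubgroup G, differentialAtOne P A = 0 := by
  simp [lieAlgebraOfSubgroup, Submodule.mem_iInf]

theorem leftTranslate_mem_vanishingIdealOfSubgroup {g : GL n K} (hg : g ∈ G)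
    {P : MvPolynomial (n × n) K} (hP : P ∈ vanishingIdealOfSubgroup G) :
    leftTranslate (g : Matrix n n K) P ∈ vanishingIdealOfSubgroup G := by
  rw [mem_vanishingIdealOfSubgroup] at hP ⊢
  intro h hh
  rw [evalMatrix_leftTranslate]
  exact hP (g * h) (mul_mem hg hh)

theorem mem_lieAlgebraOfSubgroup_iff_mem_invtSubmodule {A : Matrix n n K} :
    A ∈ lieAlgebraOfSubgroup G ↔ (vanishingIdealOfSubgroup G).restrictScalars K ∈
      Module.End.invtSubmodule (leftInvariantDerivation A).toLinearMap := by
  rw [mem_lieAlgebraOfSubgroup]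
  constructor
  · intro h P hP
    refine mem_vanishingIdealOfSubgroup.mpr fun g hg => ?_
    have hzero := h _ (leftTranslate_mem_vanishingIdealOfSubgroup hg hP)
    rwa [differentialAtOne_eq_evalMatrix_one, leftInvariantDerivation_leftTranslate,
      evalMatrix_leftTranslate, mul_one] at hzero
  · intro h P hP
    rw [differentialAtOne_eq_evalMatrix_one]
    exact mem_vanishingIdealOfSubgroup.mp (h hP) 1 (one_mem G)

theorem mem_lieAlgebraOfSubgroup_of_add_isNilpotent {S N : Matrix n n K} (hSN : Commute S N)
    (hS : ⨆ μ, Module.End.eigenspace S.mulVecLin μ = ⊤) (hN : IsNilpotent N)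
    (h : S + N ∈ lieAlgebraOfSubgroup G) : S ∈ lieAlgebraOfSubgroup G := by
  rw [mem_lieAlgebraOfSubgroup_iff_mem_invtSubmodule] at h ⊢
  rw [map_add, Derivation.coe_add_linearMap] at h
  have hN' : Module.End.maxGenEigenspace N.mulVecLin 0 = ⊤ :=
    maxGenEigenspace_zero_eq_top_of_isNilpotent (hN.map Matrix.toLinAlgEquiv')
  exact mem_invtSubmodule_of_add_of_commute (commute_leftInvariantDerivation hSN)
    (iSup_eigenspace_leftInvariantDerivation_eq_top hS)
    (maxGenEigenspace_zero_leftInvariantDerivation_eq_top hN') h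

end LieAlgebraOfSubgroup

section HeisenbergSubalgebra

variable (α β : ℂ)

theorem hElement_lie (x₁ x₂ x₃ y₁ y₂ y₃ : ℂ) :
    ⁅hElement α β x₁ x₂ x₃, hElement α β y₁ y₂ y₃⁆ =
      hElement α β 0 0 (x₁ * y₂ - x₂ * y₁) := by
  rw [Ring.lie_def]
  ext i j
  fin_cases i <;> fin_cases j <;> simp [hElement] <;> ring

theorem hElement_zero : hElement α β 0 0 0 = 0 := by
  ext i j
  fin_cases i <;> fin_cases j <;> simp [hElement]

theorem matX₁_eq_hElement : matX₁ α β = hElement α β 1 0 0 := by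
  simp [matX₁, hElement]

theorem matX₂_eq_hElement : matX₂ α β = hElement α β 0 1 0 := by
  simp [matX₂, hElement]

theorem matX₃_eq_hElement : matX₃ = hElement α β 0 0 1 := by
  simp [matX₃, hElement]

/-- The parametrization `(x₁, x₂, x₃) ↦ hElement α β x₁ x₂ x₃` of `𝔥` as a linear map. -/
noncomputable def hParametrization : (Fin 3 → ℂ) →ₗ[ℂ] Matrix (Fin 4) (Fin 4) ℂ :=
  Fintype.linearCombination ℂ ![matX₁ α β, matX₂ α β, matX₃]

theorem hParametrization_apply (x : Fin 3 → ℂ) :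
    hParametrization α β x = hElement α β (x 0) (x 1) (x 2) := by
  ext i j
  fin_cases i <;> fin_cases j <;>
    simp [hParametrization, Fintype.linearCombination_apply, Fin.sum_univ_three, hElement, matX₁,
      matX₂, matX₃] <;> ring

theorem hParametrization_injective : Function.Injective (hParametrization α β) := by
  intro x y h
  have hcol (i : Fin 4) := congrFun (congrFun h i) 3
  simp only [hParametrization_apply] at hcol
  ext k
  fin_cases k
  exacts [hcol 0, hcol 1, hcol 2]

/-- The Lie algebra `𝔥` of the matrices `hElement α β x₁ x₂ x₃`. -/
noncomputable def heisenbergSubalgebra : LieSubalgebra ℂ (Matrix (Fin 4) (Fin 4) ℂ) where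
  toSubmodule := LinearMap.range (hParametrization α β)
  lie_mem' := by
    rintro _ _ ⟨x, rfl⟩ ⟨y, rfl⟩
    refine ⟨![0, 0, x 0 * y 1 - x 1 * y 0], ?_⟩
    simp only [hParametrization_apply, hElement_lie]
    rfl

variable {α β} in
theorem mem_heisenbergSubalgebra {A : Matrix (Fin 4) (Fin 4) ℂ} :
    A ∈ heisenbergSubalgebra α β ↔ ∃ x₁ x₂ x₃ : ℂ, A = hElement α β x₁ x₂ x₃ := by
  constructor
  · rintro ⟨x, rfl⟩
    exact ⟨x 0, x 1, x 2, hParametrization_apply α β x⟩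
  · rintro ⟨x₁, x₂, x₃, rfl⟩
    exact ⟨![x₁, x₂, x₃], hParametrization_apply α β _⟩

theorem heisenbergSubalgebra_toSubmodule :
    (heisenbergSubalgebra α β).toSubmodule = Submodule.span ℂ {matX₁ α β, matX₂ α β, matX₃} := by
  refine (Fintype.range_linearCombination ℂ _).trans ?_
  simp only [Matrix.range_cons, Matrix.range_empty, Set.singleton_union, Set.union_empty]

theorem finrank_heisenbergSubalgebra : Module.finrank ℂ (heisenbergSubalgebra α β) = 3 := by
  refine (LinearMap.finrank_range_of_inj (hParametrization_injective α β)).trans ?_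
  simp

theorem isNilpotent_heisenbergSubalgebra : LieRing.IsNilpotent (heisenbergSubalgebra α β) := by
  refine isNilpotent_of_lie_lie_eq_zero fun ⟨A, hA⟩ ⟨B, hB⟩ ⟨C, hC⟩ => Subtype.ext ?_
  obtain ⟨x₁, x₂, x₃, rfl⟩ := mem_heisenbergSubalgebra.mp hA
  obtain ⟨y₁, y₂, y₃, rfl⟩ := mem_heisenbergSubalgebra.mp hB
  obtain ⟨z₁, z₂, z₃, rfl⟩ := mem_heisenbergSubalgebra.mp hC
  simp [hElement_lie, hElement_zero]

/-- The isomorphism of `𝔥` with the Heisenberg algebra that reads off the last column. -/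
def heisenbergSubalgebraEquiv : heisenbergSubalgebra α β ≃ₗ⁅ℂ⁆ heisenbergAlgebra where
  toFun A := ⟨!![0, A.1 0 3, A.1 2 3; 0, 0, A.1 1 3; 0, 0, 0], by
    intro i j hij
    fin_cases i <;> fin_cases j <;> simp at hij ⊢⟩
  map_add' A B := by
    ext i j
    fin_cases i <;> fin_cases j <;> simp
  map_smul' c A := by
    ext i j
    fin_cases i <;> fin_cases j <;> simp
  map_lie' := by
    rintro ⟨A, hA⟩ ⟨B, hB⟩
    obtain ⟨x₁, x₂, x₃, rfl⟩ := mem_heisenbergSubalgebra.mp hA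
    obtain ⟨y₁, y₂, y₃, rfl⟩ := mem_heisenbergSubalgebra.mp hB
    ext i j
    simp only [LieSubalgebra.coe_bracket, hElement_lie]
    rw [Ring.lie_def]
    fin_cases i <;> fin_cases j <;> simp [hElement]
    ring
  invFun B := ⟨hElement α β (B.1 0 1) (B.1 1 2) (B.1 0 2),
    mem_heisenbergSubalgebra.mpr ⟨_, _, _, rfl⟩⟩
  left_inv := by
    rintro ⟨A, hA⟩
    obtain ⟨x₁, x₂, x₃, rfl⟩ := mem_heisenbergSubalgebra.mp hA
    rfl
  right_inv := by
    rintro ⟨B, hB⟩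
    have hzero (i j : Fin 3) (hij : j ≤ i) : B i j = 0 := hB i j hij
    ext i j
    fin_cases i <;> fin_cases j <;> simp [hElement, hzero]

theorem matX₁_eq_add : matX₁ α β = matX₁s α β + matX₁n α β := by
  ext i j
  fin_cases i <;> fin_cases j <;> simp [matX₁, matX₁s, matX₁n] <;> ring

theorem matX₁s_mul_self : matX₁s α β * matX₁s α β = (2 : ℂ) • matX₁s α β := by
  ext i j
  fin_cases i <;> fin_cases j <;> simp [matX₁s, Matrix.mul_apply, Fin.sum_univ_four] <;> ring

theorem commute_matX₁s_matX₁n : Commute (matX₁s α β) (matX₁n α β) := by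
  ext i j
  fin_cases i <;> fin_cases j <;>
    simp [matX₁s, matX₁n, Matrix.mul_apply, Fin.sum_univ_four] <;> ring

theorem isNilpotent_matX₁n : IsNilpotent (matX₁n α β) := by
  refine ⟨3, ?_⟩
  rw [pow_succ, pow_two]
  ext i j
  fin_cases i <;> fin_cases j <;> simp [matX₁n, Matrix.mul_apply, Fin.sum_univ_four]

theorem isSemisimple_matX₁s : Module.End.IsSemisimple (Matrix.toLin' (matX₁s α β)) := by
  refine isSemisimple_of_mul_self_eq_smul two_ne_zero ?_
  rw [Module.End.mul_eq_comp, ← Matrix.toLin'_mul, matX₁s_mul_self, map_smul]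

theorem matX₁_mem_heisenbergSubalgebra : matX₁ α β ∈ heisenbergSubalgebra α β :=
  mem_heisenbergSubalgebra.mpr ⟨1, 0, 0, matX₁_eq_hElement α β⟩

theorem matX₁s_notMem_heisenbergSubalgebra : matX₁s α β ∉ heisenbergSubalgebra α β := by
  rw [mem_heisenbergSubalgebra]
  rintro ⟨x₁, x₂, x₃, h⟩
  have hx₁ : 1 / 2 = x₁ := congrFun (congrFun h 0) 3
  have hx₂ : 1 / 2 = x₂ := congrFun (congrFun h 1) 3
  have hentry : (α + β) / 2 = α * x₁ + (β - 1) * x₂ := congrFun (congrFun h 2) 0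
  subst hx₁ hx₂
  exact one_ne_zero (by linear_combination 2 * hentry : (1 : ℂ) = 0)

theorem matX₁n_notMem_heisenbergSubalgebra : matX₁n α β ∉ heisenbergSubalgebra α β := by
  intro hn
  refine matX₁s_notMem_heisenbergSubalgebra α β ?_
  rw [← add_sub_cancel_right (matX₁s α β) (matX₁n α β), ← matX₁_eq_add]
  exact sub_mem (matX₁_mem_heisenbergSubalgebra α β) hn

theorem heisenbergSubalgebra_ne_lieAlgebraOfSubgroup (G : Subgroup (GL (Fin 4) ℂ)) :
    (heisenbergSubalgebra α β).toSubmodule ≠ lieAlgebraOfSubgroup G := by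
  intro hG
  refine matX₁s_notMem_heisenbergSubalgebra α β (hG.ge ?_)
  refine mem_lieAlgebraOfSubgroup_of_add_isNilpotent (commute_matX₁s_matX₁n α β)
    (isSemisimple_matX₁s α β).iSup_eigenspace_eq_top (isNilpotent_matX₁n α β) (hG.le ?_)
  rw [← matX₁_eq_add]
  exact matX₁_mem_heisenbergSubalgebra α β

theorem not_isAlgebraicLieSubalgebra_heisenbergSubalgebra :
    ¬ IsAlgebraicLieSubalgebra (heisenbergSubalgebra α β) := fun ⟨G, _, hG⟩ =>
  heisenbergSubalgebra_ne_lieAlgebraOfSubgroup α β G hG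

theorem lie_matX₁_matX₂ : ⁅matX₁ α β, matX₂ α β⁆ = matX₃ := by
  simp [matX₁_eq_hElement, matX₂_eq_hElement, matX₃_eq_hElement α β, hElement_lie]

theorem lie_matX₁_matX₃ : ⁅matX₁ α β, matX₃⁆ = 0 := by
  simp [matX₁_eq_hElement, matX₃_eq_hElement α β, hElement_lie, hElement_zero]

theorem lie_matX₂_matX₃ : ⁅matX₂ α β, matX₃⁆ = 0 := by
  simp [matX₂_eq_hElement, matX₃_eq_hElement α β, hElement_lie, hElement_zero]

end HeisenbergSubalgebra

theorem mainTheorem1_general (α β : ℂ) :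
    ∃ 𝔥 : LieSubalgebra ℂ (Matrix (Fin 4) (Fin 4) ℂ),
      (𝔥 : Set (Matrix (Fin 4) (Fin 4) ℂ)) =
        {A | ∃ x₁ x₂ x₃ : ℂ, A = hElement α β x₁ x₂ x₃} ∧
      𝔥.toSubmodule = Submodule.span ℂ {matX₁ α β, matX₂ α β, matX₃} ∧
      Module.finrank ℂ 𝔥 = 3 ∧
      ⁅matX₁ α β, matX₂ α β⁆ = matX₃ ∧ ⁅matX₁ α β, matX₃⁆ = 0 ∧ ⁅matX₂ α β, matX₃⁆ = 0 ∧
      LieRing.IsNilpotent 𝔥 ∧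
      Nonempty (𝔥 ≃ₗ⁅ℂ⁆ heisenbergAlgebra) ∧
      matX₁ α β = matX₁s α β + matX₁n α β ∧
      Commute (matX₁s α β) (matX₁n α β) ∧
      Module.End.IsSemisimple (Matrix.toLin' (matX₁s α β)) ∧
      IsNilpotent (matX₁n α β) ∧
      matX₁s α β ∉ 𝔥 ∧ matX₁n α β ∉ 𝔥 ∧
      ¬ IsAlgebraicLieSubalgebra 𝔥 :=
  ⟨heisenbergSubalgebra α β, Set.ext fun _ => mem_heisenbergSubalgebra,
    heisenbergSubalgebra_toSubmodule α β, finrank_heisenbergSubalgebra α β,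
    lie_matX₁_matX₂ α β, lie_matX₁_matX₃ α β, lie_matX₂_matX₃ α β,
    isNilpotent_heisenbergSubalgebra α β, ⟨heisenbergSubalgebraEquiv α β⟩,
    matX₁_eq_add α β, commute_matX₁s_matX₁n α β, isSemisimple_matX₁s α β, isNilpotent_matX₁n α β,
    matX₁s_notMem_heisenbergSubalgebra α β, matX₁n_notMem_heisenbergSubalgebra α β,
    not_isAlgebraicLieSubalgebra_heisenbergSubalgebra α β⟩

theorem mainTheorem1 (α β : ℂ) (hαβ : α + β ≠ 0) :
    ∃ 𝔥 : LieSubalgebra ℂ (Matrix (Fin 4) (Fin 4) ℂ),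
      -- `𝔥` is the given subspace, with basis `X₁, X₂, X₃`
      (𝔥 : Set (Matrix (Fin 4) (Fin 4) ℂ)) =
        {A | ∃ x₁ x₂ x₃ : ℂ, A = hElement α β x₁ x₂ x₃} ∧
      𝔥.toSubmodule = Submodule.span ℂ {matX₁ α β, matX₂ α β, matX₃} ∧
      Module.finrank ℂ 𝔥 = 3 ∧
      -- bracket relations; `𝔥` is nilpotent and isomorphic to the Heisenberg algebra
      ⁅matX₁ α β, matX₂ α β⁆ = matX₃ ∧ ⁅matX₁ α β, matX₃⁆ = 0 ∧ ⁅matX₂ α β, matX₃⁆ = 0 ∧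
      LieRing.IsNilpotent 𝔥 ∧
      Nonempty (𝔥 ≃ₗ⁅ℂ⁆ heisenbergAlgebra) ∧
      -- the Jordan decomposition of `X₁`, with both parts outside `𝔥`
      matX₁ α β = matX₁s α β + matX₁n α β ∧
      Commute (matX₁s α β) (matX₁n α β) ∧
      Module.End.IsSemisimple (Matrix.toLin' (matX₁s α β)) ∧
      IsNilpotent (matX₁n α β) ∧
      matX₁s α β ∉ 𝔥 ∧ matX₁n α β ∉ 𝔥 ∧
      -- `𝔥` is not algebraic
      ¬ IsAlgebraicLieSubalgebra 𝔥 :=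
  mainTheorem1_general α β
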